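/- Let $n\in\mathbb N$, let $|\cdot|_2$ be the Euclidean norm, $|S|$ the Lebesgue measure of $S$, $\operatorname{bar}(S)=\frac1{|S|}\int_S x\,dx$ the barycenter, $u_S=\frac1{|S|}\int_S u\,dx$, $Q=(-\frac12,\frac12)^n$, $Q(x;r)=rQ+x$, $l^B(x)=Bx$ for $B\in\mathbb R^{n\times n}$, and let $\mathbb R^{n\times n}_{\rm skew}$ be the space of real skew-symmetric matrices. For $p\in[1,\infty)$ and a bounded open nonempty set $D'\subset\mathbb R^n$ put $$\alpha_p(u,D')=\inf_{A\in\mathbb R^{n\times n}_{\rm skew}}\frac1{|D'|}\int_{D'}\bigl|u(x)-A(x-\operatorname{bar}(D'))-u_{D'}\bigr|_2^p\,dx .$$ Given a bounded open nonempty set $D\subset\mathbb R^n$ and $\varepsilon>0$, let $$G_\varepsilon(u,\Omega)=\varepsilon^{n-p}\sup_{\mathcal F}\sum_{D'\in\mathcal F}\alpha_p(u,D'),$$ where $\mathcal F$ ranges over all families of pairwise disjoint translates of $\varepsilon D$ contained in $\Omega$, and let $$\psi_{\alpha_p}(B)=\lim_{\varepsilon\to0^+}G_\varepsilon(l^B,Q),\qquad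 B\in\mathbb R^{n\times n}.$$ (1) Suppose that $D$ is a bounded open reference cell for an $\varepsilon_0$-tessellation of $\mathbb R^n$ for some $\varepsilon_0>0$, i.e. for every $0<\varepsilon<\varepsilon_0$ the space $\mathbb R^n$ is covered, up to a Lebesgue null set, by pairwise disjoint translates of $\varepsilon D$. Then for every $B\in\mathbb R^{n\times n}$ the limit defining $\psi_{\alpha_p}(B)$ exists and is finite, $$\psi_{\alpha_p}(B)=\frac1{|D|}\inf_{A\in\mathbb R^{n\times n}_{\rm skew}}\frac1{|D|}\int_D\bigl|(B-A)(x-\operatorname{bar}(D))\bigr|_2^p\,dx,$$ moreover $$\{B\in\mathbb R^{n\times n}:\psi_{\alpha_p}(B)=0\}=\mathbb R^{n\times n}_{\rm skew},$$ and $\psi_{\alpha_p}(B)=\psi_{\alpha_p}\bigl(\tfrac{B+B^T}2\bigr)$ for every $B\in\mathbb R^{n\times n}$. (2) If $p=2$ and $D=Q(x;r)$ for some $x\in\mathbb R^n$ and $r>0$, then for every $B\in\mathbb R^{n\times n}$ the limit defining $\psi_{\alpha_2}(B)$ exists and is finite, and, with $A=\frac{B+B^T}2$, $$\psi_{\alpha_2}(B)=\frac1{|D|^2}\,\bigl\|\,|l^A|_2\,\bigr\|^2_{L^2(D-\operatorname{bar}(D))}.$$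 -/

import Mathlib

open Set Filter Topology MeasureTheory
open scoped ENNReal

noncomputable section

/-- `ℝⁿ` with the Euclidean norm. -/
abbrev Rn (n : ℕ) : Type := EuclideanSpace ℝ (Fin n)

/-- The space of real `n × n` matrices. -/
abbrev Mat (n : ℕ) : Type := Matrix (Fin n) (Fin n) ℝ

/-- The skew-symmetric matrices. -/
def skewMatrices (n : ℕ) : Set (Mat n) := {A | A.transpose = -A}

/-- The linear map `l^A(x) = A x`. -/
def linMap {n : ℕ} (A : Mat n) (x : Rn n) : Rn n := Matrix.toEuclideanLin A x

/-- The symmetric part `(B + Bᵀ) / 2`. -/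
def symPart {n : ℕ} (B : Mat n) : Mat n := (1 / 2 : ℝ) • (B + B.transpose)

/-- The barycenter of a set (of finite positive measure). -/
def bar {n : ℕ} (S : Set (Rn n)) : Rn n := ⨍ x in S, x

/-- The open unit cube `Q = (-1/2, 1/2)ⁿ`. -/
def unitCube (n : ℕ) : Set (Rn n) := {x | ∀ i, x i ∈ Ioo (-(1 / 2) : ℝ) (1 / 2)}

/-- The open cube `Q(x; r) = r Q + x`. -/
def cube {n : ℕ} (x : Rn n) (r : ℝ) : Set (Rn n) := (fun y => r • y + x) '' unitCube n

/-- The functional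
`α_p(u, D') = inf_{A skew} ⨍_{D'} |u(x) - A (x - bar D') - u_{D'}|^p dx`,
meant for `u ∈ L^p_loc(ℝⁿ; ℝⁿ)` and bounded nonempty open `D'`. -/
def skewFit {n : ℕ} (p : ℝ) (u : Rn n → Rn n) (D' : Set (Rn n)) : ℝ :=
  ⨅ A : skewMatrices n,
    ⨍ x in D', ‖u x - linMap (A : Mat n) (x - bar D') - ⨍ y in D', u y‖ ^ p

/-- The sets `ε R D + h` with `R ∈ 𝒢` and `h ∈ ℝⁿ` that are contained in `Ω`. -/
def copies {n : ℕ} (𝒢 : Subgroup (Matrix.specialOrthogonalGroup (Fin n) ℝ)) (D : Set (Rn n))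
    (ε : ℝ) (Ω : Set (Rn n)) : Set (Set (Rn n)) :=
  {D' | D' ⊆ Ω ∧ ∃ R ∈ 𝒢, ∃ h : Rn n, D' = (fun x => ε • linMap (R : Mat n) x + h) '' D}

/-- The BMO-type seminorm
`G_ε(u, Ω) = ε^(n-p) sup ∑_{D' ∈ F} α(u, D')`, the supremum being over all families `F` of
pairwise disjoint elements of `copies 𝒢 D ε Ω`. -/
def bmoSeminorm {n : ℕ} (p : ℝ) (𝒢 : Subgroup (Matrix.specialOrthogonalGroup (Fin n) ℝ))
    (D : Set (Rn n)) (α : (Rn n → Rn n) → Set (Rn n) → ℝ) (ε : ℝ)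
    (u : Rn n → Rn n) (Ω : Set (Rn n)) : ℝ≥0∞ :=
  ENNReal.ofReal (ε ^ ((n : ℝ) - p)) *
    ⨆ F ∈ {F : Set (Set (Rn n)) | F ⊆ copies 𝒢 D ε Ω ∧ F.PairwiseDisjoint id},
      ∑' D' : F, ENNReal.ofReal (α u D')

/-- `ψ_α(B) = lim_{ε → 0⁺} G_ε(l^B, Q)`. -/
def psi {n : ℕ} (p : ℝ) (𝒢 : Subgroup (Matrix.specialOrthogonalGroup (Fin n) ℝ))
    (D : Set (Rn n)) (α : (Rn n → Rn n) → Set (Rn n) → ℝ) (B : Mat n) : ℝ :=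
  (limUnder (𝓝[>] (0 : ℝ))
    (fun ε => bmoSeminorm p 𝒢 D α ε (linMap B) (unitCube n))).toReal

/-- The limit defining `ψ_α(B)` exists and is finite. -/
def PsiWellDefined {n : ℕ} (p : ℝ) (𝒢 : Subgroup (Matrix.specialOrthogonalGroup (Fin n) ℝ))
    (D : Set (Rn n)) (α : (Rn n → Rn n) → Set (Rn n) → ℝ) (B : Mat n) : Prop :=
  ∃ ℓ : ℝ≥0∞, ℓ ≠ ∞ ∧ Tendsto
    (fun ε => bmoSeminorm p 𝒢 D α ε (linMap B) (unitCube n)) (𝓝[>] (0 : ℝ)) (𝓝 ℓ)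

/-- `D` is a reference cell for an `ε₀`-tessellation of `ℝⁿ`: for every `0 < ε < ε₀`, the space is
filled, up to a Lebesgue null set, by pairwise disjoint translates of `ε D`. -/
def IsReferenceCell {n : ℕ} (ε₀ : ℝ) (D : Set (Rn n)) : Prop :=
  ∀ ε : ℝ, 0 < ε → ε < ε₀ → ∃ T : Set (Rn n),
    (T.PairwiseDisjoint fun t => (fun x => ε • x + t) '' D) ∧
      volume (⋃ t ∈ T, (fun x => ε • x + t) '' D)ᶜ = 0

end

/-! For the linear map `linMap B`, subtracting the mean removes the translation and the p-th power
is homogeneous, so the fit on `ε D + h` is `ε ^ p * skewDist p D B`, whatever `h` is. Multiplied by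
`ε ^ (n - p)`, each cell contributes `skewDist p D B / |D|` times its own volume. Hence `G_ε` is
exactly this constant times the largest volume packed in `Q` by disjoint translates of `ε D`
(`bmoSeminorm_linMap_eq`), and a tessellation makes that volume tend to 1
(`tendsto_packingVolume_unitCube`).

The zero set comes from `⟨Ax, x⟩ = 0` for skew `A`: the quadratic form of `B` bounds every
competitor from below, so a vanishing infimum makes the form vanish on an open set, hence everywhere
(`mem_skewMatrices_of_skewDist_eq_zero`). Passing to the symmetric part only shifts the competitor
`A`.

Cubes tile at every scale. The second moments of a centred cube form a multiple of the identity, so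
symmetric and skew linear maps are orthogonal in `L²` over it, and `A = 0` is optimal for the
symmetric part (`skewDist_two_cube`). -/

/-! ### Integrals and averages under homothety and translation. -/

section Scaling

variable {n : ℕ}

theorem isOpen_smul_add_image {D : Set (Rn n)} (hD : IsOpen D) {ε : ℝ} (hε : ε ≠ 0) (h : Rn n) :
    IsOpen ((fun x => ε • x + h) '' D) := by
  have := ((Homeomorph.smulOfNeZero ε hε).trans (Homeomorph.addRight h)).isOpenMap D hD
  exact this

open scoped Pointwise in
theorem volume_smul_add_image (D : Set (Rn n)) (ε : ℝ) (h : Rn n) :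
    volume ((fun x => ε • x + h) '' D) = ENNReal.ofReal (|ε| ^ n) * volume D := by
  have : (fun x => ε • x + h) '' D = (fun x => x + h) '' (ε • D) := by
    rw [← image_smul, image_image]
  rw [this, image_add_right, measure_preimage_add_right, Measure.addHaar_smul]
  simp [abs_pow]

theorem setIntegral_smul_add_image {F : Type*} [NormedAddCommGroup F] [NormedSpace ℝ F]
    {D : Set (Rn n)} (hD : MeasurableSet D) {ε : ℝ} (hε : ε ≠ 0) (h : Rn n) (f : Rn n → F) :
    ∫ x in (fun x => ε • x + h) '' D, f x = |ε| ^ n • ∫ x in D, f (ε • x + h) := by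
  have hd : ∀ x ∈ D, HasFDerivWithinAt (fun x : Rn n => ε • x + h)
      (ε • ContinuousLinearMap.id ℝ (Rn n)) D x := fun x _ =>
    (((hasFDerivWithinAt_id x D).const_smul ε).add_const h)
  have hi : InjOn (fun x : Rn n => ε • x + h) D := fun x _ y _ hxy => by
    simpa [hε] using hxy
  rw [integral_image_eq_integral_abs_det_fderiv_smul volume hD hd hi f, integral_smul]
  congr 1
  rw [ContinuousLinearMap.det, ContinuousLinearMap.toLinearMap_smul, LinearMap.det_smul]
  simp [abs_pow]

theorem setAverage_smul_add_image {F : Type*} [NormedAddCommGroup F] [NormedSpace ℝ F]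
    {D : Set (Rn n)} (hD : MeasurableSet D) {ε : ℝ} (hε : ε ≠ 0) (h : Rn n) (f : Rn n → F) :
    ⨍ x in (fun x => ε • x + h) '' D, f x = ⨍ x in D, f (ε • x + h) := by
  have h0 : |ε| ^ n ≠ 0 := pow_ne_zero _ (abs_ne_zero.2 hε)
  rw [setAverage_eq, setAverage_eq, setIntegral_smul_add_image hD hε, measureReal_def,
    volume_smul_add_image, ENNReal.toReal_mul, ENNReal.toReal_ofReal (by positivity), smul_smul,
    mul_inv, mul_right_comm, inv_mul_cancel₀ h0, one_mul, measureReal_def]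

theorem Continuous.integrableOn_of_isBounded {F : Type*} [NormedAddCommGroup F] {f : Rn n → F}
    (hf : Continuous f) {D : Set (Rn n)} (hD : Bornology.IsBounded D) : IntegrableOn f D :=
  (hf.continuousOn.integrableOn_compact hD.isCompact_closure).mono_set subset_closure

end Scaling

/-! ### Linear maps and skew-symmetry as vanishing of the quadratic form. -/

section LinMap

variable {n : ℕ}

/-- `linMap A` as a continuous linear map. -/
noncomputable def linMapCLM (A : Mat n) : Rn n →L[ℝ] Rn n :=
  LinearMap.toContinuousLinearMap (Matrix.toEuclideanLin A)

theorem linMapCLM_apply (A : Mat n) (x : Rn n) : linMapCLM A x = linMap A x := rfl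

theorem continuous_linMap (A : Mat n) : Continuous (linMap A) := (linMapCLM A).continuous

theorem linMap_add (A : Mat n) (x y : Rn n) : linMap A (x + y) = linMap A x + linMap A y :=
  map_add (linMapCLM A) x y

theorem linMap_sub (A : Mat n) (x y : Rn n) : linMap A (x - y) = linMap A x - linMap A y :=
  map_sub (linMapCLM A) x y

theorem linMap_smul (A : Mat n) (c : ℝ) (x : Rn n) : linMap A (c • x) = c • linMap A x :=
  map_smul (linMapCLM A) c x

theorem sub_linMap (A B : Mat n) (x : Rn n) : linMap (A - B) x = linMap A x - linMap B x := by
  simp [linMap]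

theorem one_linMap (x : Rn n) : linMap (1 : Mat n) x = x := by
  simp [linMap]

theorem zero_linMap (x : Rn n) : linMap (0 : Mat n) x = 0 := by
  simp [linMap]

theorem linMap_apply (A : Mat n) (x : Rn n) (i : Fin n) : linMap A x i = ∑ j, A i j * x j := by
  simp [linMap, Matrix.toLpLin_apply, Matrix.mulVec, dotProduct]

theorem inner_linMap (A : Mat n) (x y : Rn n) :
    inner ℝ (linMap A x) y = ∑ i, ∑ j, A i j * x j * y i := by
  simp [PiLp.inner_apply, linMap_apply, Finset.mul_sum, mul_comm]

theorem inner_linMap_self_eq_zero {A : Mat n} (hA : A ∈ skewMatrices n) (x : Rn n) :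
    inner ℝ (linMap A x) x = 0 := by
  have h1 := inner_linMap A x x
  have h2 : ∑ i, ∑ j, A i j * x j * x i = - ∑ i, ∑ j, A i j * x j * x i := by
    conv_lhs => rw [Finset.sum_comm]
    rw [← Finset.sum_neg_distrib]
    refine Finset.sum_congr rfl fun i _ => ?_
    rw [← Finset.sum_neg_distrib]
    refine Finset.sum_congr rfl fun j _ => ?_
    have : A j i = - A i j := congrFun (congrFun hA i) j
    rw [this]; ring
  rw [h1]; linarith

theorem mem_skewMatrices_of_inner_eq_zero {B : Mat n}
    (h : ∀ x, inner ℝ (linMap B x) x = 0) : B ∈ skewMatrices n := by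
  ext i j
  have e : ∀ i j : Fin n, inner ℝ (linMap B (EuclideanSpace.single i 1)) (EuclideanSpace.single j 1)
      = B j i := fun i j => by
    rw [EuclideanSpace.inner_single_right]; simp [linMap_apply]
  -- Polarisation: the form at `e_i + e_j` leaves only `B j i + B i j`.
  have h1 := h (EuclideanSpace.single i 1 + EuclideanSpace.single j 1)
  rw [linMap_add, inner_add_left, inner_add_right, inner_add_right, h, h, e, e] at h1
  simp only [Matrix.transpose_apply, Matrix.neg_apply]
  linarith

theorem symPart_eq_sub (B : Mat n) : ∃ K ∈ skewMatrices n, symPart B = B - K := by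
  refine ⟨(1 / 2 : ℝ) • (B - B.transpose), ?_, ?_⟩
  · ext i j; simp; ring
  · ext i j; simp [symPart]; ring

theorem setAverage_linMap {D : Set (Rn n)} (hD : Bornology.IsBounded D) (B : Mat n) :
    ⨍ y in D, linMap B y = linMap B (bar D) := by
  have := (linMapCLM B).integral_comp_comm (continuous_id.integrableOn_of_isBounded hD)
  simp only [linMapCLM_apply, id] at this
  rw [bar, setAverage_eq, setAverage_eq, this, linMap_smul]

end LinMap

/-! ### Distance to the skew-symmetric matrices. -/

section SkewFit

variable {n : ℕ}

/-- The optimal `L^p` distance of `B` to the skew-symmetric matrices, averaged over the centred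
domain. -/
noncomputable def skewDist (p : ℝ) (D : Set (Rn n)) (B : Mat n) : ℝ :=
  ⨅ A : skewMatrices n, ⨍ x in D, ‖linMap (B - (A : Mat n)) (x - bar D)‖ ^ p

instance : Nonempty (skewMatrices n) := ⟨⟨0, by simp [skewMatrices]⟩⟩

theorem setAverage_nonneg {D : Set (Rn n)} {f : Rn n → ℝ} (hf : ∀ x, 0 ≤ f x) :
    0 ≤ ⨍ x in D, f x := by
  rw [setAverage_eq]
  exact smul_nonneg (by positivity) (integral_nonneg hf)

theorem skewDist_nonneg (p : ℝ) (D : Set (Rn n)) (B : Mat n) : 0 ≤ skewDist p D B :=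
  Real.iInf_nonneg fun _ => setAverage_nonneg fun _ => by positivity

theorem skewDist_le (p : ℝ) (D : Set (Rn n)) (B : Mat n) {A : Mat n} (hA : A ∈ skewMatrices n) :
    skewDist p D B ≤ ⨍ x in D, ‖linMap (B - A) (x - bar D)‖ ^ p :=
  ciInf_le (f := fun A : skewMatrices n => ⨍ x in D, ‖linMap (B - (A : Mat n)) (x - bar D)‖ ^ p)
    ⟨0, by rintro _ ⟨A, rfl⟩; exact setAverage_nonneg fun _ => by positivity⟩ ⟨A, hA⟩

theorem bar_smul_add_image {D : Set (Rn n)} (hD : IsOpen D) (hb : Bornology.IsBounded D)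
    (hne : D.Nonempty) {ε : ℝ} (hε : ε ≠ 0) (h : Rn n) :
    bar ((fun x => ε • x + h) '' D) = ε • bar D + h := by
  have hv : volume.real D ≠ 0 := by
    rw [measureReal_def, ENNReal.toReal_ne_zero]
    exact ⟨(hD.measure_pos volume hne).ne', hb.measure_lt_top.ne⟩
  rw [bar, setAverage_smul_add_image hD.measurableSet hε, bar, setAverage_eq, setAverage_eq,
    integral_add ((continuous_const_smul ε).integrableOn_of_isBounded hb)
      (continuous_const.integrableOn_of_isBounded hb), integral_smul, setIntegral_const,
      smul_add, smul_smul, smul_smul _ _ h, inv_mul_cancel₀ hv, one_smul, smul_comm, smul_smul,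
      mul_comm]

theorem skewFit_linMap_smul_add_image {p : ℝ} {D : Set (Rn n)} (hD : IsOpen D)
    (hb : Bornology.IsBounded D) (hne : D.Nonempty) {ε : ℝ} (hε : 0 < ε) (h : Rn n) (B : Mat n) :
    skewFit p (linMap B) ((fun x => ε • x + h) '' D) = ε ^ p * skewDist p D B := by
  have hb' : Bornology.IsBounded ((fun x => ε • x + h) '' D) :=
    (hb.isCompact_closure.image
      (by fun_prop : Continuous fun x : Rn n => ε • x + h)).isBounded.subset
      (image_mono subset_closure)
  rw [skewDist, Real.mul_iInf_of_nonneg (by positivity), skewFit]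
  refine iInf_congr fun A => ?_
  rw [setAverage_linMap hb', bar_smul_add_image hD hb hne hε.ne',
    setAverage_smul_add_image hD.measurableSet hε.ne', setAverage_eq, setAverage_eq,
    smul_eq_mul, smul_eq_mul, mul_left_comm (ε ^ p), ← integral_const_mul (ε ^ p)]
  congr 1
  refine integral_congr_ae (Eventually.of_forall fun x => ?_)
  dsimp only
  rw [← Real.norm_of_nonneg hε.le, ← Real.mul_rpow (norm_nonneg _) (norm_nonneg _), ← norm_smul,
    Real.norm_of_nonneg hε.le, sub_linMap]
  congr 2
  simp only [linMap_add, linMap_sub, linMap_smul, smul_sub]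
  abel

theorem skewDist_symPart (p : ℝ) (D : Set (Rn n)) (B : Mat n) :
    skewDist p D (symPart B) = skewDist p D B := by
  obtain ⟨K, hK, hB⟩ := symPart_eq_sub B
  have hK' : K.transpose = -K := hK
  -- Skew matrices form a group under addition, so each competitor on one side is shifted by `K` to
  -- give one on the other.
  refine le_antisymm (le_ciInf fun A => ?_) (le_ciInf fun A => ?_)
  · have hA : (A : Mat n).transpose = -A := A.2
    have := skewDist_le p D (symPart B) (A := A - K) (by simp [skewMatrices, hA, hK']; abel)
    rw [hB, sub_sub_sub_cancel_right] at this
    rwa [hB]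
  · have hA : (A : Mat n).transpose = -A := A.2
    have := skewDist_le p D B (A := K + A) (by simp [skewMatrices, hA, hK']; abel)
    rwa [← sub_sub, ← hB] at this

theorem skewDist_eq_zero_of_mem {p : ℝ} (hp : 1 ≤ p) (D : Set (Rn n)) {B : Mat n}
    (hB : B ∈ skewMatrices n) : skewDist p D B = 0 := by
  refine le_antisymm ((skewDist_le p D B hB).trans_eq ?_) (skewDist_nonneg _ _ _)
  simp [zero_linMap, Real.zero_rpow (zero_lt_one.trans_le hp).ne']

/-- Adding the values of the form at `x + t v` and `x - t v` cancels the cross terms and leaves `2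
t² ⟨Bv, v⟩`; the centre `b` need not lie in `D`. -/
theorem inner_linMap_self_eq_zero_of_isOpen {B : Mat n} {b : Rn n} {D : Set (Rn n)}
    (hD : IsOpen D) (hne : D.Nonempty) (h : ∀ x ∈ D, inner ℝ (linMap B (x - b)) (x - b) = 0)
    (v : Rn n) : inner ℝ (linMap B v) v = 0 := by
  obtain ⟨x, hx⟩ := hne
  have h1 : ∀ᶠ t : ℝ in 𝓝 0, x + t • v ∈ D :=
    (by fun_prop : Continuous fun t : ℝ => x + t • v).continuousAt.eventually_mem
      (hD.mem_nhds (by simpa using hx))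
  have h2 : ∀ᶠ t : ℝ in 𝓝 0, x - t • v ∈ D :=
    (by fun_prop : Continuous fun t : ℝ => x - t • v).continuousAt.eventually_mem
      (hD.mem_nhds (by simpa using hx))
  obtain ⟨t, ⟨ht1, ht2⟩, ht⟩ :=
    (((h1.and h2).filter_mono nhdsWithin_le_nhds).and
      (self_mem_nhdsWithin (s := ({0}ᶜ : Set ℝ)))).exists
  have e0 := h x hx
  have e1 := h _ ht1
  have e2 := h _ ht2
  rw [add_sub_right_comm, linMap_add, linMap_smul] at e1
  rw [sub_right_comm, linMap_sub, linMap_smul] at e2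
  simp only [inner_add_left, inner_add_right, inner_sub_left (linMap B (x - b)) (t • linMap B v),
    inner_sub_right _ (x - b) (t • v), inner_smul_left, inner_smul_right, e0] at e1 e2
  have ht0 : t ≠ 0 := ht
  have : t ^ 2 * inner ℝ (linMap B v) v = 0 := by
    simp at e1 e2; linarith
  simpa [ht0] using this

theorem mem_skewMatrices_of_skewDist_eq_zero {p : ℝ} (hp : 1 ≤ p) {D : Set (Rn n)}
    (hD : IsOpen D) (hb : Bornology.IsBounded D) (hne : D.Nonempty) {B : Mat n}
    (h0 : skewDist p D B = 0) : B ∈ skewMatrices n := by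
  have hp0 : 0 < p := zero_lt_one.trans_le hp
  set b := bar D
  obtain ⟨R, hR0, hR⟩ : ∃ R : ℝ, 0 < R ∧ ∀ x ∈ D, ‖x - b‖ ≤ R := by
    obtain ⟨R, hR⟩ := hb.subset_closedBall b
    refine ⟨max R 1, by positivity, fun x hx => ?_⟩
    have := hR hx
    rw [mem_closedBall_iff_norm] at this
    exact this.trans (le_max_left _ _)
  -- A minorant independent of `A`: Cauchy–Schwarz and `‖x - b‖ ≤ R` bound it by `‖(B - A)(x - b)‖ ^
  -- p` on `D`.
  set f : Rn n → ℝ := fun x => (|inner ℝ (linMap B (x - b)) (x - b)| / R) ^ p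
  have hfc : Continuous f := by
    have := continuous_linMap B
    refine Continuous.rpow_const ?_ fun _ => Or.inr hp0.le
    fun_prop
  have hf0 : ∀ x, 0 ≤ f x := fun x => by positivity
  have hle : ⨍ x in D, f x ≤ skewDist p D B := by
    refine le_ciInf fun A => ?_
    rw [setAverage_eq, setAverage_eq]
    refine smul_le_smul_of_nonneg_left ?_ (by positivity)
    refine setIntegral_mono_on (hfc.integrableOn_of_isBounded hb)
      (Continuous.integrableOn_of_isBounded ?_ hb) hD.measurableSet fun x hx => ?_
    · have := continuous_linMap (B - (A : Mat n))
      refine Continuous.rpow_const ?_ fun _ => Or.inr hp0.le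
      fun_prop
    · refine Real.rpow_le_rpow (by positivity) ?_ hp0.le
      rw [div_le_iff₀ hR0]
      have : inner ℝ (linMap B (x - b)) (x - b)
          = inner ℝ (linMap (B - (A : Mat n)) (x - b)) (x - b) := by
        rw [sub_linMap, inner_sub_left, inner_linMap_self_eq_zero A.2, sub_zero]
      rw [this]
      exact (abs_real_inner_le_norm _ _).trans
        (mul_le_mul_of_nonneg_left (hR x hx) (norm_nonneg _))
  have hI : ∫ x in D, f x = 0 := by
    have h1 : ⨍ x in D, f x = 0 := le_antisymm (hle.trans_eq h0) (setAverage_nonneg hf0)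
    rw [setAverage_eq, smul_eq_zero] at h1
    refine h1.resolve_left (inv_ne_zero ?_)
    rw [measureReal_def, ENNReal.toReal_ne_zero]
    exact ⟨(hD.measure_pos volume hne).ne', hb.measure_lt_top.ne⟩
  rw [setIntegral_eq_zero_iff_of_nonneg_ae (Eventually.of_forall hf0)
    (hfc.integrableOn_of_isBounded hb)] at hI
  have hz : EqOn f 0 D := Measure.eqOn_open_of_ae_eq hI hD hfc.continuousOn continuousOn_const
  refine mem_skewMatrices_of_inner_eq_zero
    (inner_linMap_self_eq_zero_of_isOpen hD hne (b := b) fun x hx => ?_)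
  have := hz hx
  simpa [f, Real.rpow_eq_zero_iff_of_nonneg (by positivity : 0 ≤ |inner ℝ (linMap B (x - b)) (x - b)| / R),
    hR0.ne', hp0.ne'] using this

end SkewFit

/-! ### Packing the unit cube by cells, and the limit. -/

section Packing

variable {n : ℕ}

theorem mem_copies_bot {D : Set (Rn n)} {ε : ℝ} {Ω D' : Set (Rn n)} :
    D' ∈ copies ⊥ D ε Ω ↔ D' ⊆ Ω ∧ ∃ h : Rn n, D' = (fun x => ε • x + h) '' D := by
  simp [copies, Subgroup.mem_bot, one_linMap]

theorem volume_unitCube : volume (unitCube n) = 1 := by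
  have h : unitCube n = (MeasurableEquiv.toLp 2 (Fin n → ℝ)).symm ⁻¹'
      (univ.pi fun _ => Ioo (-(1 / 2) : ℝ) (1 / 2)) := by
    ext x; simp [unitCube]
  rw [h, (EuclideanSpace.volume_preserving_symm_measurableEquiv_toLp (Fin n)).measure_preimage
    (MeasurableSet.univ_pi fun _ => measurableSet_Ioo).nullMeasurableSet, Real.volume_pi_Ioo]
  norm_num

/-- The largest volume filled by disjoint translates of `ε D` inside `Ω`. -/
noncomputable def packingVolume (D : Set (Rn n)) (ε : ℝ) (Ω : Set (Rn n)) : ℝ≥0∞ :=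
  ⨆ F ∈ {F : Set (Set (Rn n)) | F ⊆ copies ⊥ D ε Ω ∧ F.PairwiseDisjoint id}, volume (⋃₀ F)

theorem tsum_skewFit_eq {p : ℝ} {D : Set (Rn n)} (hD : IsOpen D) (hb : Bornology.IsBounded D)
    (hne : D.Nonempty) {ε : ℝ} (hε : 0 < ε) (B : Mat n) {Ω : Set (Rn n)} {F : Set (Set (Rn n))}
    (hF : F ⊆ copies ⊥ D ε Ω) (hd : F.PairwiseDisjoint id) :
    ENNReal.ofReal (ε ^ ((n : ℝ) - p)) * ∑' D' : F, ENNReal.ofReal (skewFit p (linMap B) D') =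
      ENNReal.ofReal (skewDist p D B / volume.real D) * volume (⋃₀ F) := by
  have hv0 : volume D ≠ 0 := (hD.measure_pos volume hne).ne'
  have hv : 0 < volume.real D := ENNReal.toReal_pos hv0 hb.measure_lt_top.ne
  have hopen : ∀ D' ∈ F, IsOpen D' := fun D' h => by
    obtain ⟨-, t, rfl⟩ := mem_copies_bot.1 (hF h)
    exact isOpen_smul_add_image hD hε.ne' t
  have hcount : F.Countable := hd.countable_of_isOpen hopen fun D' h => by
    obtain ⟨-, t, rfl⟩ := mem_copies_bot.1 (hF h)
    exact hne.image _
  rw [measure_sUnion hcount hd fun D' h => (hopen D' h).measurableSet, ← ENNReal.tsum_mul_left,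
    ← ENNReal.tsum_mul_left]
  refine tsum_congr fun D' => ?_
  obtain ⟨-, t, ht⟩ := mem_copies_bot.1 (hF D'.2)
  rw [ht, skewFit_linMap_smul_add_image hD hb hne hε, volume_smul_add_image,
    ← ENNReal.ofReal_toReal hb.measure_lt_top.ne, ← measureReal_def,
    ← ENNReal.ofReal_mul (by positivity), ← ENNReal.ofReal_mul (by positivity),
    ← ENNReal.ofReal_mul (div_nonneg (skewDist_nonneg _ _ _) hv.le)]
  congr 1
  -- The powers of `ε` combine to `ε ^ n`, the Jacobian factor in the volume of a cell.
  rw [abs_of_pos hε, ← mul_assoc, ← Real.rpow_add hε, sub_add_cancel, Real.rpow_natCast]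
  field_simp

theorem bmoSeminorm_linMap_eq {p : ℝ} {D : Set (Rn n)} (hD : IsOpen D)
    (hb : Bornology.IsBounded D) (hne : D.Nonempty) {ε : ℝ} (hε : 0 < ε) (B : Mat n)
    (Ω : Set (Rn n)) :
    bmoSeminorm p ⊥ D (skewFit p) ε (linMap B) Ω =
      ENNReal.ofReal (skewDist p D B / volume.real D) * packingVolume D ε Ω := by
  rw [bmoSeminorm, packingVolume]
  simp only [ENNReal.mul_iSup]
  exact iSup_congr fun F => iSup_congr fun hF => tsum_skewFit_eq hD hb hne hε B hF.1 hF.2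

theorem packingVolume_le (D : Set (Rn n)) (ε : ℝ) (Ω : Set (Rn n)) :
    packingVolume D ε Ω ≤ volume Ω :=
  iSup₂_le fun _ hF => measure_mono (sUnion_subset fun _ h => (hF.1 h).1)

open scoped Pointwise in
-- The tiles meeting the shrunken cube `(1 - 2εd) Q` cover almost all of it. Each coordinate varies
-- by at most `εd` on a tile, which is the margin between the two cubes, so these tiles stay inside
-- `Q`.
theorem le_packingVolume_unitCube {D : Set (Rn n)} {d : ℝ}
    (hd : ∀ x ∈ D, ∀ y ∈ D, dist x y ≤ d) {ε₀ : ℝ} (hcell : IsReferenceCell ε₀ D) {ε : ℝ}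
    (hε : 0 < ε) (hε₀ : ε < ε₀) (hs : 0 < 1 - 2 * (ε * d)) :
    ENNReal.ofReal ((1 - 2 * (ε * d)) ^ n) ≤ packingVolume D ε (unitCube n) := by
  obtain ⟨T, hT, hc⟩ := hcell ε hε hε₀
  set s := 1 - 2 * (ε * d)
  set S : Set (Rn n) := s • unitCube n
  have hvol : volume S = ENNReal.ofReal (s ^ n) := by
    rw [Measure.addHaar_smul, volume_unitCube, mul_one, finrank_euclideanSpace_fin,
      abs_of_nonneg (by positivity)]
  set F : Set (Set (Rn n)) :=
    {D' | ∃ t ∈ T, D' = (fun x => ε • x + t) '' D ∧ (D' ∩ S).Nonempty}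
  have hF : F ⊆ copies ⊥ D ε (unitCube n) := by
    rintro D' ⟨t, -, rfl, x, ⟨a, ha, rfl⟩, ⟨q, hq, hx⟩⟩
    refine mem_copies_bot.2 ⟨?_, t, rfl⟩
    rintro _ ⟨y, hy, rfl⟩ i
    have h1 : |y i - a i| ≤ d := by
      have := (PiLp.norm_apply_le (y - a) i).trans_eq (dist_eq_norm y a).symm
      exact (by simpa using this : |y i - a i| ≤ dist y a).trans (hd y hy a ha)
    have h2 : s * q i = ε * a i + t i := by
      have := congrArg (fun z : Rn n => z i) hx
      simpa using this
    have h3 := hq i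
    obtain ⟨h4, h5⟩ := abs_le.1 h1
    have h6 := mul_le_mul_of_nonneg_left h4 hε.le
    have h7 := mul_le_mul_of_nonneg_left h5 hε.le
    simp only [PiLp.add_apply, PiLp.smul_apply, smul_eq_mul]
    constructor <;> nlinarith [mul_lt_mul_of_pos_left h3.1 hs, mul_lt_mul_of_pos_left h3.2 hs]
  have hFd : F.PairwiseDisjoint id := by
    rintro _ ⟨t, ht, rfl, -⟩ _ ⟨t', ht', rfl, -⟩ hne
    exact hT ht ht' fun h => hne (by rw [h])
  have hsub : S ⊆ ⋃₀ F ∪ (⋃ t ∈ T, (fun x => ε • x + t) '' D)ᶜ := by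
    intro x hx
    by_cases h : x ∈ ⋃ t ∈ T, (fun x => ε • x + t) '' D
    · obtain ⟨t, ht, hxt⟩ := mem_iUnion₂.1 h
      exact Or.inl ⟨_, ⟨t, ht, rfl, x, hxt, hx⟩, hxt⟩
    · exact Or.inr h
  calc ENNReal.ofReal (s ^ n) = volume S := hvol.symm
    _ ≤ volume (⋃₀ F) + volume (⋃ t ∈ T, (fun x => ε • x + t) '' D)ᶜ :=
      (measure_mono hsub).trans (measure_union_le _ _)
    _ = volume (⋃₀ F) := by rw [hc, add_zero]
    _ ≤ packingVolume D ε (unitCube n) :=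
      le_iSup₂ (f := fun F (_ : F ∈ {F : Set (Set (Rn n)) |
        F ⊆ copies ⊥ D ε (unitCube n) ∧ F.PairwiseDisjoint id}) => volume (⋃₀ F)) F ⟨hF, hFd⟩

theorem tendsto_packingVolume_unitCube {D : Set (Rn n)} (hb : Bornology.IsBounded D) {ε₀ : ℝ}
    (hε₀ : 0 < ε₀) (hcell : IsReferenceCell ε₀ D) :
    Tendsto (fun ε => packingVolume D ε (unitCube n)) (𝓝[>] 0) (𝓝 1) := by
  obtain ⟨d, hd⟩ : ∃ d : ℝ, ∀ x ∈ D, ∀ y ∈ D, dist x y ≤ d :=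
    ⟨Metric.diam D, fun x hx y hy => Metric.dist_le_diam_of_mem hb hx hy⟩
  have hc : Continuous fun ε : ℝ => 1 - 2 * (ε * d) := by fun_prop
  have hlow : Tendsto (fun ε : ℝ => ENNReal.ofReal ((1 - 2 * (ε * d)) ^ n)) (𝓝[>] 0) (𝓝 1) := by
    have : Continuous fun ε : ℝ => ENNReal.ofReal ((1 - 2 * (ε * d)) ^ n) :=
      ENNReal.continuous_ofReal.comp (hc.pow n)
    exact ((this.tendsto' 0 1 (by simp)).mono_left nhdsWithin_le_nhds)
  have hev : ∀ᶠ ε : ℝ in 𝓝[>] 0, 0 < 1 - 2 * (ε * d) :=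
    ((hc.tendsto' 0 1 (by simp)).eventually (lt_mem_nhds one_pos)).filter_mono nhdsWithin_le_nhds
  refine tendsto_of_tendsto_of_tendsto_of_le_of_le' hlow tendsto_const_nhds ?_
    (Eventually.of_forall fun ε => (packingVolume_le D ε _).trans_eq volume_unitCube)
  filter_upwards [hev, Ioo_mem_nhdsGT hε₀] with ε h1 h2
  exact le_packingVolume_unitCube hd hcell h2.1 h2.2 h1

theorem IsReferenceCell.nonempty {D : Set (Rn n)} {ε₀ : ℝ} (hε₀ : 0 < ε₀)
    (hcell : IsReferenceCell ε₀ D) : D.Nonempty := by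
  rw [nonempty_iff_ne_empty]
  rintro rfl
  obtain ⟨T, -, hT⟩ := hcell (ε₀ / 2) (half_pos hε₀) (half_lt_self hε₀)
  have h := volume_unitCube (n := n)
  rw [measure_mono_null (subset_univ _) (by simpa using hT)] at h
  exact zero_ne_one h

theorem tendsto_bmoSeminorm_linMap (p : ℝ) {D : Set (Rn n)} (hD : IsOpen D)
    (hb : Bornology.IsBounded D) {ε₀ : ℝ} (hε₀ : 0 < ε₀) (hcell : IsReferenceCell ε₀ D)
    (B : Mat n) :
    Tendsto (fun ε => bmoSeminorm p ⊥ D (skewFit p) ε (linMap B) (unitCube n)) (𝓝[>] 0)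
      (𝓝 (ENNReal.ofReal (skewDist p D B / volume.real D))) := by
  have h := ENNReal.Tendsto.const_mul (a := ENNReal.ofReal (skewDist p D B / volume.real D))
    (tendsto_packingVolume_unitCube hb hε₀ hcell) (Or.inr ENNReal.ofReal_ne_top)
  rw [mul_one] at h
  refine h.congr' ?_
  filter_upwards [self_mem_nhdsWithin] with ε hε
  exact (bmoSeminorm_linMap_eq hD hb (hcell.nonempty hε₀) hε B _).symm

theorem psiWellDefined_skewFit (p : ℝ) {D : Set (Rn n)} (hD : IsOpen D)
    (hb : Bornology.IsBounded D) {ε₀ : ℝ} (hε₀ : 0 < ε₀) (hcell : IsReferenceCell ε₀ D)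
    (B : Mat n) : PsiWellDefined p ⊥ D (skewFit p) B :=
  ⟨_, ENNReal.ofReal_ne_top, tendsto_bmoSeminorm_linMap p hD hb hε₀ hcell B⟩

theorem psi_skewFit_eq (p : ℝ) {D : Set (Rn n)} (hD : IsOpen D)
    (hb : Bornology.IsBounded D) {ε₀ : ℝ} (hε₀ : 0 < ε₀) (hcell : IsReferenceCell ε₀ D)
    (B : Mat n) : psi p ⊥ D (skewFit p) B = 1 / volume.real D * skewDist p D B := by
  rw [psi, (tendsto_bmoSeminorm_linMap p hD hb hε₀ hcell B).limUnder_eq,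
    ENNReal.toReal_ofReal (div_nonneg (skewDist_nonneg _ _ _) measureReal_nonneg), div_mul_eq_mul_div,
    one_mul]

theorem psi_skewFit_eq_zero_iff {p : ℝ} (hp : 1 ≤ p) {D : Set (Rn n)} (hD : IsOpen D)
    (hb : Bornology.IsBounded D) {ε₀ : ℝ} (hε₀ : 0 < ε₀) (hcell : IsReferenceCell ε₀ D)
    (B : Mat n) : psi p ⊥ D (skewFit p) B = 0 ↔ B ∈ skewMatrices n := by
  have hne := hcell.nonempty hε₀
  have hv : 0 < volume.real D :=
    ENNReal.toReal_pos (hD.measure_pos volume hne).ne' hb.measure_lt_top.ne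
  rw [psi_skewFit_eq p hD hb hε₀ hcell, mul_eq_zero, or_iff_right (by positivity)]
  exact ⟨mem_skewMatrices_of_skewDist_eq_zero hp hD hb hne, skewDist_eq_zero_of_mem hp D⟩

end Packing

/-! ### Cubes: tessellation, moments and the quadratic case. -/

section Cube

variable {n : ℕ}

theorem isOpen_unitCube : IsOpen (unitCube n) := by
  simp only [unitCube, ← mem_preimage, ofPred_forall]
  exact isOpen_iInter_of_finite fun i => isOpen_Ioo.preimage (by fun_prop : Continuous fun x : Rn n => x i)

theorem isBounded_unitCube : Bornology.IsBounded (unitCube n) := by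
  -- The crude radius `n` suffices, since `‖x‖² ≤ n ≤ n²`.
  refine (Metric.isBounded_iff_subset_closedBall 0).2 ⟨∑ _i : Fin n, 1, fun x hx => ?_⟩
  rw [mem_closedBall_zero_iff]
  rw [EuclideanSpace.norm_eq]
  refine Real.sqrt_le_iff.2 ⟨by positivity, ?_⟩
  have h1 : ∑ i, ‖x i‖ ^ 2 ≤ ∑ _i : Fin n, (1 : ℝ) := Finset.sum_le_sum fun i _ => by
    have := hx i
    rw [Real.norm_eq_abs, sq_abs]
    nlinarith [this.1, this.2]
  refine h1.trans ?_
  simp only [Finset.sum_const, Finset.card_univ, Fintype.card_fin, nsmul_eq_mul, mul_one]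
  exact_mod_cast Nat.le_self_pow two_ne_zero n

theorem zero_mem_unitCube : (0 : Rn n) ∈ unitCube n := fun i => by norm_num

theorem mem_cube {x y : Rn n} {r : ℝ} (hr : 0 < r) :
    y ∈ cube x r ↔ ∀ i, |y i - x i| < r / 2 := by
  constructor
  · rintro ⟨q, hq, rfl⟩ i
    have := hq i
    simp only [PiLp.add_apply, PiLp.smul_apply, smul_eq_mul, add_sub_cancel_right]
    rw [abs_lt]
    constructor <;> nlinarith [this.1, this.2]
  · intro h
    refine ⟨r⁻¹ • (y - x), fun i => ?_, by simp [smul_smul, hr.ne']⟩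
    have := abs_lt.1 (h i)
    simp only [PiLp.sub_apply, PiLp.smul_apply, smul_eq_mul, inv_mul_eq_div]
    rw [mem_Ioo, lt_div_iff₀ hr, div_lt_iff₀ hr]
    constructor <;> linarith

theorem smul_add_image_cube (x : Rn n) (r ε : ℝ) (t : Rn n) :
    (fun y => ε • y + t) '' cube x r = cube (ε • x + t) (ε * r) := by
  rw [cube, cube, image_image]
  refine image_congr fun y _ => ?_
  rw [smul_add, smul_smul, add_assoc]

theorem volume_hyperplane (i : Fin n) (c : ℝ) : volume {y : Rn n | y i = c} = 0 := by
  have h := (EuclideanSpace.volume_preserving_symm_measurableEquiv_toLp (Fin n)).measure_preimage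
    (s := {f | f i = c}) (measurableSet_eq_fun (measurable_pi_apply i)
      measurable_const).nullMeasurableSet
  rw [volume_pi, Measure.pi_hyperplane] at h
  exact h

/-- The translations form the lattice `εr ℤⁿ`; only points on countably many hyperplanes, the cell
faces, are missed. -/
theorem isReferenceCell_cube (x : Rn n) {r : ℝ} (hr : 0 < r) (ε₀ : ℝ) :
    IsReferenceCell ε₀ (cube x r) := by
  intro ε hε _
  have hl : 0 < ε * r := mul_pos hε hr
  set l := ε * r with hldef
  let v : (Fin n → ℤ) → Rn n := fun k => WithLp.toLp 2 fun i => l * k i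
  refine ⟨range v, ?_, ?_⟩
  · rintro _ ⟨k, rfl⟩ _ ⟨k', rfl⟩ hne
    rw [Function.onFun, smul_add_image_cube, smul_add_image_cube, disjoint_left]
    intro y hy hy'
    rw [mem_cube hl] at hy hy'
    refine hne (congrArg v (funext fun i => ?_))
    have h1 := abs_lt.1 (hy i)
    have h2 := abs_lt.1 (hy' i)
    simp only [PiLp.add_apply, v] at h1 h2
    have h3 : ((k i : ℝ) - k' i) < 1 := by
      refine lt_of_mul_lt_mul_left ?_ hl.le
      linarith
    have h4 : ((k' i : ℝ) - k i) < 1 := by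
      refine lt_of_mul_lt_mul_left ?_ hl.le
      linarith
    have h5 : k i - k' i < 1 := by exact_mod_cast h3
    have h6 : k' i - k i < 1 := by exact_mod_cast h4
    omega
  · refine measure_mono_null (t := ⋃ i : Fin n, ⋃ m : ℤ,
      {y : Rn n | y i = (ε • x) i + l * (m + 1 / 2)}) (fun y hy => ?_)
      (measure_iUnion_null fun i => measure_iUnion_null fun m => volume_hyperplane i _)
    by_contra hcon
    simp only [mem_iUnion, mem_ofPred_eq, not_exists] at hcon
    refine hy (mem_iUnion₂.2 ⟨_, ⟨fun i => round ((y i - (ε • x) i) / l), rfl⟩, ?_⟩)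
    rw [smul_add_image_cube, mem_cube hl]
    intro i
    set z := (y i - (ε • x) i) / l with hz
    have hyz : y i = (ε • x) i + l * z := by rw [hz]; field_simp; ring
    have h1 := abs_sub_round z
    -- A tie in rounding puts `y` on a face: index `round z` for the upper one, `round z - 1` for
    -- the lower.
    have h2 : |z - round z| ≠ 1 / 2 := fun h => by
      rcases (abs_eq (by norm_num : (0 : ℝ) ≤ 1 / 2)).1 h with h | h
      · exact hcon i (round z) (by rw [hyz]; congr 2; linarith)
      · exact hcon i (round z - 1) (by rw [hyz]; congr 2; push_cast; linarith)
    have h3 : |z - round z| < 1 / 2 := lt_of_le_of_ne h1 h2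
    have h4 : y i - (ε • x + v fun i => round ((y i - (ε • x) i) / l)) i = l * (z - round z) := by
      simp only [PiLp.add_apply, v, ← hz]
      rw [hyz]; ring
    rw [h4, abs_mul, abs_of_pos hl]
    nlinarith

theorem setIntegral_unitCube_comp {F : Type*} [NormedAddCommGroup F] [NormedSpace ℝ F]
    (U : Rn n ≃ₗᵢ[ℝ] Rn n) (hU : ∀ x, U x ∈ unitCube n ↔ x ∈ unitCube n) (f : Rn n → F) :
    ∫ x in unitCube n, f (U x) = ∫ x in unitCube n, f x := by
  have h := U.measurePreserving.setIntegral_preimage_emb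
    U.toHomeomorph.measurableEmbedding f (unitCube n)
  rwa [show U ⁻¹' unitCube n = unitCube n from ext hU] at h

theorem bar_unitCube : bar (unitCube n) = 0 := by
  have h := setIntegral_unitCube_comp (LinearIsometryEquiv.neg ℝ) (n := n)
    (fun x => forall_congr' fun i => by
      simp only [LinearIsometryEquiv.coe_neg, PiLp.neg_apply, mem_Ioo]
      constructor <;> rintro ⟨h1, h2⟩ <;> constructor <;> linarith) id
  have h2 : -∫ x in unitCube n, x = ∫ x in unitCube n, x :=
    (integral_neg fun x : Rn n => x).symm.trans h
  have h3 : (2 : ℝ) • ∫ x in unitCube n, x = 0 := by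
    rw [two_smul]
    nth_rw 1 [← h2]
    exact neg_add_cancel _
  rw [bar, setAverage_eq, (smul_eq_zero.1 h3).resolve_left two_ne_zero, smul_zero]

/-- Reflecting the `i`-th coordinate preserves the cube and changes the sign of the integrand. -/
theorem setIntegral_unitCube_mul_of_ne {i j : Fin n} (hij : i ≠ j) :
    ∫ y in unitCube n, y i * y j = 0 := by
  let e : Fin n → ℝ ≃ₗᵢ[ℝ] ℝ := fun k =>
    if k = i then LinearIsometryEquiv.neg ℝ else LinearIsometryEquiv.refl ℝ ℝ
  let U : Rn n ≃ₗᵢ[ℝ] Rn n := LinearIsometryEquiv.piLpCongrRight 2 e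
  have hU : ∀ x k, U x k = if k = i then - x k else x k := fun x k => by
    simp only [U, e, LinearIsometryEquiv.piLpCongrRight_apply]
    split_ifs <;> simp
  have h := setIntegral_unitCube_comp U (fun x => forall_congr' fun k => by
    rw [hU]
    split_ifs
    · simp only [mem_Ioo]
      constructor <;> rintro ⟨h1, h2⟩ <;> constructor <;> linarith
    · rfl) fun y => y i * y j
  simp only [hU, if_true, if_neg hij.symm, neg_mul, integral_neg, neg_eq_self] at h
  exact h

theorem setIntegral_unitCube_sq_eq (i j : Fin n) :
    ∫ y in unitCube n, y i * y i = ∫ y in unitCube n, y j * y j := by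
  let U : Rn n ≃ₗᵢ[ℝ] Rn n := LinearIsometryEquiv.piLpCongrLeft 2 ℝ ℝ (Equiv.swap i j)
  have hU : ∀ x k, U x k = x (Equiv.swap i j k) := fun x k => by
    simp [U, LinearIsometryEquiv.piLpCongrLeft_apply, Equiv.piCongrLeft', Equiv.symm_swap]
  have h := setIntegral_unitCube_comp U (fun x => by
    simp only [unitCube, mem_ofPred_eq, hU]
    exact ⟨fun h k => by simpa using h (Equiv.swap i j k), fun h k => h _⟩) fun y => y j * y j
  simpa only [hU, Equiv.swap_apply_right] using h

/-- With second moments `c I`, the integral is `c` times the Frobenius product of `S` and `K`, which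
changes sign under transposition. -/
theorem setIntegral_unitCube_inner_linMap {S K : Mat n} (hS : S.transpose = S)
    (hK : K ∈ skewMatrices n) :
    ∫ y in unitCube n, (inner ℝ (linMap S y) (linMap K y) : ℝ) = 0 := by
  have hint : ∀ f : Rn n → ℝ, Continuous f → Integrable f (volume.restrict (unitCube n)) :=
    fun f hf => hf.integrableOn_of_isBounded isBounded_unitCube
  have h1 : ∀ y : Rn n, (inner ℝ (linMap S y) (linMap K y) : ℝ)
      = ∑ i, ∑ j, ∑ k, S i j * K i k * (y j * y k) := fun y => by
    simp only [PiLp.inner_apply, linMap_apply, RCLike.inner_apply, conj_trivial]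
    refine Finset.sum_congr rfl fun i _ => ?_
    rw [mul_comm, Finset.sum_mul_sum]
    refine Finset.sum_congr rfl fun j _ => Finset.sum_congr rfl fun k _ => by ring
  have h2 : ∫ y in unitCube n, (inner ℝ (linMap S y) (linMap K y) : ℝ)
      = ∑ i, ∑ j, S i j * K i j * ∫ y in unitCube n, y i * y i := by
    simp only [h1]
    rw [integral_finsetSum _ fun i _ => hint _ (by fun_prop)]
    refine Finset.sum_congr rfl fun i _ => ?_
    rw [integral_finsetSum _ fun j _ => hint _ (by fun_prop)]
    refine Finset.sum_congr rfl fun j _ => ?_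
    rw [integral_finsetSum _ fun k _ => hint _ (by fun_prop)]
    rw [Finset.sum_eq_single j]
    · rw [integral_const_mul, setIntegral_unitCube_sq_eq j i]
    · intro k _ hk
      rw [integral_const_mul, setIntegral_unitCube_mul_of_ne hk.symm, mul_zero]
    · simp
  have h3 : ∑ i, ∑ j, S i j * K i j * ∫ y in unitCube n, y i * y i
      = - ∑ i, ∑ j, S i j * K i j * ∫ y in unitCube n, y i * y i := by
    conv_lhs => rw [Finset.sum_comm]
    rw [← Finset.sum_neg_distrib]
    refine Finset.sum_congr rfl fun i _ => ?_
    rw [← Finset.sum_neg_distrib]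
    refine Finset.sum_congr rfl fun j _ => ?_
    have e1 : S j i = S i j := congrFun (congrFun hS i) j
    have e2 : K j i = - K i j := congrFun (congrFun hK i) j
    rw [e1, e2, setIntegral_unitCube_sq_eq j i]; ring
  rw [h2]; linarith

theorem transpose_symPart (B : Mat n) : (symPart B).transpose = symPart B := by
  simp [symPart, add_comm]

theorem isOpen_cube (x : Rn n) {r : ℝ} (hr : 0 < r) : IsOpen (cube x r) :=
  isOpen_smul_add_image isOpen_unitCube hr.ne' x

theorem isBounded_cube (x : Rn n) (r : ℝ) : Bornology.IsBounded (cube x r) :=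
  (isBounded_unitCube.isCompact_closure.image
    (by fun_prop : Continuous fun y : Rn n => r • y + x)).isBounded.subset
    (image_mono subset_closure)

theorem bar_cube (x : Rn n) {r : ℝ} (hr : 0 < r) : bar (cube x r) = x := by
  rw [cube, bar_smul_add_image isOpen_unitCube isBounded_unitCube ⟨0, zero_mem_unitCube⟩ hr.ne',
    bar_unitCube, smul_zero, zero_add]

theorem setAverage_cube_norm_sq (x : Rn n) {r : ℝ} (hr : 0 < r) (M : Mat n) :
    ⨍ y in cube x r, ‖linMap M (y - bar (cube x r))‖ ^ (2 : ℝ) =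
      r ^ 2 * ∫ y in unitCube n, ‖linMap M y‖ ^ 2 := by
  rw [bar_cube x hr, cube, setAverage_smul_add_image isOpen_unitCube.measurableSet hr.ne',
    setAverage_eq, measureReal_def, volume_unitCube, ENNReal.toReal_one, inv_one, one_smul,
    ← integral_const_mul]
  simp [linMap_smul, norm_smul, mul_pow]

theorem skewDist_two_cube (x : Rn n) {r : ℝ} (hr : 0 < r) (B : Mat n) :
    skewDist 2 (cube x r) B =
      ⨍ y in cube x r, ‖linMap (symPart B) (y - bar (cube x r))‖ ^ (2 : ℝ) := by
  rw [← skewDist_symPart]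
  refine le_antisymm ?_ (le_ciInf fun A => ?_)
  · have := skewDist_le 2 (cube x r) (symPart B) (A := 0) (by simp [skewMatrices])
    rwa [sub_zero] at this
  · rw [setAverage_cube_norm_sq x hr, setAverage_cube_norm_sq x hr]
    refine mul_le_mul_of_nonneg_left ?_ (by positivity)
    have h0 := setIntegral_unitCube_inner_linMap (transpose_symPart B) A.2
    have hS := continuous_linMap (symPart B)
    have hA := continuous_linMap (A : Mat n)
    have hSA := continuous_linMap (symPart B - (A : Mat n))
    have hint : ∀ f : Rn n → ℝ, Continuous f → Integrable f (volume.restrict (unitCube n)) :=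
      fun f hf => hf.integrableOn_of_isBounded isBounded_unitCube
    -- The cross term integrates to zero, so `A` only adds the nonnegative `‖A y‖²`.
    calc ∫ y in unitCube n, ‖linMap (symPart B) y‖ ^ 2
        = ∫ y in unitCube n, (‖linMap (symPart B) y‖ ^ 2
            - 2 * inner ℝ (linMap (symPart B) y) (linMap (A : Mat n) y)) := by
          rw [integral_sub (hint _ (by fun_prop)) (hint _ (by fun_prop)), integral_const_mul, h0,
            mul_zero, sub_zero]
      _ ≤ ∫ y in unitCube n, ‖linMap (symPart B - (A : Mat n)) y‖ ^ 2 := by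
          refine integral_mono (hint _ (by fun_prop)) (hint _ (by fun_prop)) fun y => ?_
          dsimp only
          rw [sub_linMap, norm_sub_sq_real]
          linarith [sq_nonneg ‖linMap (A : Mat n) y‖]

theorem eLpNorm_two_sq_image_sub (S : Mat n) {D : Set (Rn n)} (hD : MeasurableSet D)
    (hb : Bornology.IsBounded D) (hv : volume.real D ≠ 0) (b : Rn n) :
    (eLpNorm (fun y => ‖linMap S y‖) 2
      (volume.restrict ((fun y => y - b) '' D))).toReal ^ 2 =
        volume.real D * ⨍ y in D, ‖linMap S (y - b)‖ ^ (2 : ℝ) := by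
  have hc : Continuous fun y => ‖linMap S y‖ := (continuous_linMap S).norm
  have hb' : Bornology.IsBounded ((fun y => y - b) '' D) :=
    (hb.isCompact_closure.image (by fun_prop : Continuous fun y : Rn n => y - b)).isBounded.subset
      (image_mono subset_closure)
  have hm : MemLp (fun y => ‖linMap S y‖) 2 (volume.restrict ((fun y => y - b) '' D)) :=
    (memLp_two_iff_integrable_sq hc.aestronglyMeasurable).2
      ((hc.pow 2).integrableOn_of_isBounded hb')
  have hI : ∫ y in (fun y => y - b) '' D, ‖linMap S y‖ ^ (2 : ℝ)
      = ∫ y in D, ‖linMap S (y - b)‖ ^ (2 : ℝ) := by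
    have := setIntegral_smul_add_image hD one_ne_zero (-b) fun y => ‖linMap S y‖ ^ (2 : ℝ)
    simpa [← sub_eq_add_neg] using this
  rw [hm.eLpNorm_eq_integral_rpow_norm two_ne_zero ENNReal.ofNat_ne_top,
    ENNReal.toReal_ofReal (by positivity), ENNReal.toReal_ofNat, ← Real.rpow_natCast,
    ← Real.rpow_mul (integral_nonneg fun _ => by positivity), Nat.cast_ofNat,
    inv_mul_cancel₀ two_ne_zero, Real.rpow_one]
  simp only [norm_norm]
  rw [hI, setAverage_eq, smul_eq_mul, mul_inv_cancel_left₀ hv]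

end Cube

theorem mainTheorem12 (n : ℕ) :
    (∀ p : ℝ, 1 ≤ p → ∀ D : Set (Rn n), IsOpen D → Bornology.IsBounded D →
      (∃ ε₀ : ℝ, 0 < ε₀ ∧ IsReferenceCell ε₀ D) →
        (∀ B : Mat n, PsiWellDefined p ⊥ D (skewFit p) B) ∧
        (∀ B : Mat n, psi p ⊥ D (skewFit p) B =
          1 / volume.real D *
            ⨅ A : skewMatrices n, ⨍ x in D, ‖linMap (B - (A : Mat n)) (x - bar D)‖ ^ p) ∧
        {B : Mat n | psi p ⊥ D (skewFit p) B = 0} = skewMatrices n ∧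
        (∀ B : Mat n, psi p ⊥ D (skewFit p) B = psi p ⊥ D (skewFit p) (symPart B))) ∧
    (∀ (x : Rn n) (r : ℝ), 0 < r → ∀ D : Set (Rn n), D = cube x r → ∀ B : Mat n,
      PsiWellDefined 2 ⊥ D (skewFit 2) B ∧
      psi 2 ⊥ D (skewFit 2) B =
        1 / volume.real D ^ 2 *
          (eLpNorm (fun y => ‖linMap (symPart B) y‖) 2
            (volume.restrict ((fun y => y - bar D) '' D))).toReal ^ 2) := by
  constructor
  · rintro p hp D hD hb ⟨ε₀, hε₀, hcell⟩
    refine ⟨psiWellDefined_skewFit p hD hb hε₀ hcell, psi_skewFit_eq p hD hb hε₀ hcell,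
      ext (psi_skewFit_eq_zero_iff hp hD hb hε₀ hcell), fun B => ?_⟩
    rw [psi_skewFit_eq p hD hb hε₀ hcell, psi_skewFit_eq p hD hb hε₀ hcell, skewDist_symPart]
  · rintro x r hr D rfl B
    have hD := isOpen_cube x hr
    have hb := isBounded_cube x r
    -- Cubes tessellate at every scale, so the threshold 1 is arbitrary.
    have hcell := isReferenceCell_cube x hr 1
    have hv : 0 < volume.real (cube x r) := ENNReal.toReal_pos
      (hD.measure_pos volume (hcell.nonempty one_pos)).ne' hb.measure_lt_top.ne
    refine ⟨psiWellDefined_skewFit 2 hD hb one_pos hcell B, ?_⟩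
    rw [psi_skewFit_eq 2 hD hb one_pos hcell, skewDist_two_cube x hr,
      eLpNorm_two_sq_image_sub _ hD.measurableSet hb hv.ne']
    -- The second factor `1 / |D|` is the normalisation of the average, undone by the `L²` norm.
    field_simp
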